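/- All graphs are finite and simple. For a graph $G$ with vertex set $V$, $|V|=n$, let $\mathcal S(G)$ be the set of real symmetric $n\times n$ matrices, indexed by $V$, whose $(i,j)$-entry with $i\ne j$ is nonzero if and only if $\{i,j\}$ is an edge of $G$ (the diagonal entries are arbitrary). Let $\overline G$ be the complement of $G$, and for $\beta\subseteq E(\overline G)$ let $G+\beta$ be the graph obtained from $G$ by adding the edges in $\beta$. Write $\circ$ for the entrywise product and $[A,X]=AX-XA$. A real symmetric matrix $A$ has the SSP (respectively, the SAP) if $X=O$ is the only real symmetric matrix with $A\circ X=I\circ X=O$ and $[A,X]=O$ (respectively, $AX=O$). If $A\in\mathcal S(G)$ and $H\supseteq G$ is a graph on the same vertex set $V$, then $A$ has the SSP (respectively, the SAP) with respect to $H$ if $X=O$ is the only real symmetric matrix with zero diagonal, whose $(i,j)$-entries with $i\neq j$ are zero unless $\{i,j\}\in E(\overline H)$, that satisfies $[A,X]=O$ (respectively, $AX=O$). A nonempty set $\beta\subseteq E(\overline G)$ is an SSP (respectively, SAP) liberation set of $A\in\mathcal S(G)$ if $A$ has the SSP (respectively, the SAP) with respect to $G+\beta'$ for every $\beta'\subset\beta$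 with $|\beta'|=|\beta|-1$; it is an SSP (respectively, SAP) liberation set of $G$ if it is one of every $A\in\mathcal S(G)$. Let $q(G)$ be the minimum number of distinct eigenvalues of a matrix in $\mathcal S(G)$, and $q_S(G)$ the minimum number of distinct eigenvalues of a matrix in $\mathcal S(G)$ with the SSP. Let $M(G)$ be the maximum nullity of a matrix in $\mathcal S(G)$, and $\xi(G)$ the maximum nullity of a matrix in $\mathcal S(G)$ with the SAP. **Corollary.** Let $G$ be a graph. 1. If $\beta$ is an SSP liberation set of $G$, then $q(G+\beta)\le q_S(G+\beta)\le q(G)\le q_S(G)$. 2. If $\beta$ is an SAP liberation set of $G$, then $M(G+\beta)\ge \xi(G+\beta)\ge M(G)\ge \xi(G)$. -/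

import Mathlib

open scoped Matrix

namespace Liberation

variable {V : Type*} [Fintype V] [DecidableEq V]

/-- `S(G)`: the real symmetric matrices whose off-diagonal `(i,j)`-entry is nonzero if and only if
`{i,j}` is an edge of `G`; the diagonal is unconstrained. -/
def matrixClass (G : SimpleGraph V) : Set (Matrix V V ℝ) :=
  {A | A.IsSymm ∧ ∀ i j, i ≠ j → (A i j ≠ 0 ↔ G.Adj i j)}

/-- `S₀^cl(G)`: the real symmetric matrices with zero diagonal whose off-diagonal `(i,j)`-entry is
nonzero only if `{i,j}` is an edge of `G`. -/
def closedClassZeroDiag (G : SimpleGraph V) : Set (Matrix V V ℝ) :=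
  {X | X.IsSymm ∧ (∀ i, X i i = 0) ∧ ∀ i j, i ≠ j → X i j ≠ 0 → G.Adj i j}

/-- The strong spectral property: `X = O` is the only symmetric matrix with
`A ∘ X = I ∘ X = O` and `[A, X] = O`. -/
def HasSSP (A : Matrix V V ℝ) : Prop :=
  A.IsSymm ∧ ∀ X : Matrix V V ℝ, X.IsSymm →
    A ⊙ X = 0 → (1 : Matrix V V ℝ) ⊙ X = 0 → A * X - X * A = 0 → X = 0

/-- The strong Arnold property: `X = O` is the only symmetric matrix with
`A ∘ X = I ∘ X = O` and `A X = O`. -/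
def HasSAP (A : Matrix V V ℝ) : Prop :=
  A.IsSymm ∧ ∀ X : Matrix V V ℝ, X.IsSymm →
    A ⊙ X = 0 → (1 : Matrix V V ℝ) ⊙ X = 0 → A * X = 0 → X = 0

/-- `A` has the SSP with respect to `H` (used for `A ∈ S(G)` with `H` a spanning supergraph
of `G`). -/
def HasSSPWrt (A : Matrix V V ℝ) (H : SimpleGraph V) : Prop :=
  ∀ X ∈ closedClassZeroDiag Hᶜ, A * X - X * A = 0 → X = 0

/-- `A` has the SAP with respect to `H` (used for `A ∈ S(G)` with `H` a spanning supergraph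
of `G`). -/
def HasSAPWrt (A : Matrix V V ℝ) (H : SimpleGraph V) : Prop :=
  ∀ X ∈ closedClassZeroDiag Hᶜ, A * X = 0 → X = 0

/-- The graph `G + β` obtained from `G` by adding the edges in `β`. -/
def addEdges (G : SimpleGraph V) (β : Finset (Sym2 V)) : SimpleGraph V :=
  G ⊔ SimpleGraph.fromEdgeSet (β : Set (Sym2 V))

/-- `β` is an SSP liberation set of the matrix `A ∈ S(G)`: a nonempty set of nonedges of `G` such
that `A` has the SSP with respect to `G + β'` for every `β' ⊆ β` with `|β'| = |β| - 1`. -/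
def IsMatrixSSPLiberationSet (G : SimpleGraph V) (A : Matrix V V ℝ) (β : Finset (Sym2 V)) : Prop :=
  β.Nonempty ∧ (β : Set (Sym2 V)) ⊆ Gᶜ.edgeSet ∧
    ∀ β' ⊆ β, β'.card + 1 = β.card → HasSSPWrt A (addEdges G β')

/-- `β` is an SAP liberation set of the matrix `A ∈ S(G)`: a nonempty set of nonedges of `G` such
that `A` has the SAP with respect to `G + β'` for every `β' ⊆ β` with `|β'| = |β| - 1`. -/
def IsMatrixSAPLiberationSet (G : SimpleGraph V) (A : Matrix V V ℝ) (β : Finset (Sym2 V)) : Prop :=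
  β.Nonempty ∧ (β : Set (Sym2 V)) ⊆ Gᶜ.edgeSet ∧
    ∀ β' ⊆ β, β'.card + 1 = β.card → HasSAPWrt A (addEdges G β')

/-- `β` is an SSP liberation set of the graph `G`. -/
def IsSSPLiberationSet (G : SimpleGraph V) (β : Finset (Sym2 V)) : Prop :=
  ∀ A ∈ matrixClass G, IsMatrixSSPLiberationSet G A β

/-- `β` is an SAP liberation set of the graph `G`. -/
def IsSAPLiberationSet (G : SimpleGraph V) (β : Finset (Sym2 V)) : Prop :=
  ∀ A ∈ matrixClass G, IsMatrixSAPLiberationSet G A β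

/-- The number of distinct eigenvalues of a real symmetric matrix (all of them are real). -/
noncomputable def numDistinctEigenvalues (A : Matrix V V ℝ) : ℕ :=
  (spectrum ℝ A).ncard

/-- The nullity of a real matrix: the dimension of its kernel. -/
noncomputable def nullity (A : Matrix V V ℝ) : ℕ :=
  Module.finrank ℝ (LinearMap.ker A.mulVecLin)

/-- `q(G)`: the least number of distinct eigenvalues of a matrix in `S(G)`. -/
noncomputable def q (G : SimpleGraph V) : ℕ :=
  sInf {k | ∃ A ∈ matrixClass G, numDistinctEigenvalues A = k}

/-- `q_S(G)`: the least number of distinct eigenvalues of a matrix in `S(G)` with the SSP.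
Every graph has such a matrix, so this is the minimum of a nonempty set. -/
noncomputable def qS (G : SimpleGraph V) : ℕ :=
  sInf {k | ∃ A ∈ matrixClass G, HasSSP A ∧ numDistinctEigenvalues A = k}

/-- `M(G)`: the largest nullity of a matrix in `S(G)`; nullities are at most `|V|`, so this is the
maximum of a bounded set. -/
noncomputable def maxNullity (G : SimpleGraph V) : ℕ :=
  sSup {k | ∃ A ∈ matrixClass G, nullity A = k}

/-- `ξ(G)`: the largest nullity of a matrix in `S(G)` with the SAP. -/
noncomputable def xi (G : SimpleGraph V) : ℕ :=
  sSup {k | ∃ A ∈ matrixClass G, HasSAP A ∧ nullity A = k}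

end Liberation

open scoped Matrix

open Filter Topology

namespace Liberation

/-! Take `A ∈ S(G)` attaining `q(G)` or `M(G)`. It suffices to find `B = A + tY` in `S(G + β)`,
close to `A`, isospectral (or of equal nullity) and with the strong property. The Cayley equation
`(1 + tZ) B (1 - tZ) = (1 - tZ) A (1 + tZ)` with `Z` skew, or the congruence `B = (1 + tZ)ᵀ A (1 +
tZ)`, becomes `Y + T Z + t R(t, Z, Y) = 0` after division by `t`, with `T` linear.

By trace duality (`exists_add_eq_of_forall_trace`), the strong property with respect to `H` makes
the pattern matrices of `H` and the image of `T` span all symmetric matrices. For `H = G + (β \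
{e})` this solves `Y + T Z = 0` on the pattern of `G + β` with `Y` nonzero at `e`. Finitely many
nonzero functionals have a common point of nonvanishing, so one solution is nonzero on all of `β`
(`exists_direction`). The same spanning lets `exists_zero_of_perturbation` carry it to small `t ≠
0`. The strong property survives because it is open. -/

/-! ### Analytic tools: persistence of solutions and openness of injectivity. -/

/-- If the linear map `L` sends the subspace `U` onto `W`, every solution `u₀ ∈ U` of `L u = 0`
persists under a small smooth `W`-valued perturbation of the equation. -/
theorem exists_zero_of_perturbation {E F : Type*} [NormedAddCommGroup E] [NormedSpace ℝ E]
    [FiniteDimensional ℝ E] [NormedAddCommGroup F] [NormedSpace ℝ F] [FiniteDimensional ℝ F]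
    (U : Submodule ℝ E) (W : Submodule ℝ F) (L : E →ₗ[ℝ] F) (R : ℝ × E → F)
    (hR : ContDiff ℝ 1 R) (hLU : ∀ u ∈ U, L u ∈ W) (hRU : ∀ t, ∀ u ∈ U, R (t, u) ∈ W)
    (hsurj : ∀ w ∈ W, ∃ u ∈ U, L u = w) (u₀ : E) (hu₀ : u₀ ∈ U) (hLu₀ : L u₀ = 0)
    (s : Set (ℝ × E)) (hs : s ∈ 𝓝 ((0 : ℝ), u₀)) :
    ∀ᶠ t in 𝓝 (0 : ℝ), ∃ u ∈ U, (t, u) ∈ s ∧ L u + t • R (t, u) = 0 := by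
  -- Projecting to `W` gives a map whose derivative can be onto; no equation is lost, since all
  -- values lie in `W`.
  obtain ⟨π, hπ⟩ := W.subtype.exists_leftInverse_of_injective (by simp)
  have hπW : ∀ w ∈ W, ((π w : W) : F) = w := fun w hw => by
    have := LinearMap.congr_fun hπ ⟨w, hw⟩
    exact congrArg Subtype.val this
  let ι : ℝ × U →L[ℝ] ℝ × E :=
    (ContinuousLinearMap.fst ℝ ℝ U).prod (U.subtypeL ∘L ContinuousLinearMap.snd ℝ ℝ U)
  let πc : F →L[ℝ] W := LinearMap.toContinuousLinearMap π
  let Lc : E →L[ℝ] F := LinearMap.toContinuousLinearMap L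
  let x₀ : ℝ × U := (0, ⟨u₀, hu₀⟩)
  have hRd : HasStrictFDerivAt (fun x : ℝ × U => R (ι x)) (fderiv ℝ (fun x => R (ι x)) x₀) x₀ :=
    ((hR.comp ι.contDiff).contDiffAt).hasStrictFDerivAt (by simp)
  have hfst : HasStrictFDerivAt (fun x : ℝ × U => x.1) (ContinuousLinearMap.fst ℝ ℝ U) x₀ :=
    (ContinuousLinearMap.fst ℝ ℝ U).hasStrictFDerivAt
  have hLd : HasStrictFDerivAt (fun x : ℝ × U => Lc (ι x).2)
      (Lc ∘L U.subtypeL ∘L ContinuousLinearMap.snd ℝ ℝ U) x₀ :=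
    (Lc ∘L U.subtypeL ∘L ContinuousLinearMap.snd ℝ ℝ U).hasStrictFDerivAt
  -- Keeping `t` as a coordinate of the output makes the image neighbourhood contain `(t, 0)` for
  -- every small `t`.
  have hd := hfst.prodMk (πc.hasStrictFDerivAt.comp x₀ (hLd.add (hfst.smul hRd)))
  have hmap := hd.map_nhds_eq_of_surj (by
    rw [LinearMap.range_eq_top]
    rintro ⟨a, w⟩
    obtain ⟨u, hu, hLu⟩ := hsurj (w - πc (a • R (ι x₀)) : W) (Submodule.coe_mem _)
    refine ⟨(a, ⟨u, hu⟩), ?_⟩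
    have h0 : πc (L u) = w - πc (a • R (ι x₀)) := by
      apply Subtype.ext
      rw [hLu]
      exact hπW _ (Submodule.coe_mem _)
    have h1 : πc (Lc u + a • R (ι x₀)) = w := by
      rw [map_add]
      change πc (L u) + _ = _
      rw [h0]; simp
    simpa [x₀] using h1)
  have hs' : ι ⁻¹' s ∈ 𝓝 x₀ := ι.continuous.continuousAt.preimage_mem_nhds (by simpa [ι, x₀] using hs)
  have him := image_mem_map (m := fun x : ℝ × U => (x.1, πc (Lc (ι x).2 + x.1 • R (ι x)))) hs'
  have hval : ((x₀.1, πc (Lc (ι x₀).2 + x₀.1 • R (ι x₀))) : ℝ × W) = (0, 0) := by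
    simp [x₀, ι, Lc, hLu₀]
  have him' : (fun x : ℝ × U => (x.1, πc (Lc (ι x).2 + x.1 • R (ι x)))) '' (ι ⁻¹' s)
      ∈ 𝓝 ((0 : ℝ), (0 : W)) := by
    rw [← hval]
    have := him
    erw [hmap] at this
    exact this
  have hcont : Tendsto (fun t : ℝ => (t, (0 : W))) (𝓝 0) (𝓝 ((0 : ℝ), (0 : W))) :=
    (Continuous.prodMk_left (0 : W)).tendsto 0
  filter_upwards [hcont him'] with t ht
  obtain ⟨⟨t', u⟩, hx, he⟩ := ht
  simp only [Prod.mk.injEq] at he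
  obtain ⟨rfl, he⟩ := he
  refine ⟨u, u.2, hx, ?_⟩
  have hmem : L u + t' • R (t', (u : E)) ∈ W :=
    W.add_mem (hLU _ u.2) (W.smul_mem _ (hRU _ _ u.2))
  rw [← hπW _ hmem]
  exact congrArg Subtype.val he

/-- In a linear family of linear maps, having trivial kernel is an open condition. -/
theorem isOpen_setOf_forall_eq_zero {M E F : Type*} [NormedAddCommGroup M] [NormedSpace ℝ M]
    [FiniteDimensional ℝ M] [NormedAddCommGroup E] [NormedSpace ℝ E] [FiniteDimensional ℝ E]
    [NormedAddCommGroup F] [NormedSpace ℝ F] [FiniteDimensional ℝ F] (Φ : M →ₗ[ℝ] E →ₗ[ℝ] F)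
    (S : Submodule ℝ E) : IsOpen {B : M | ∀ x ∈ S, Φ B x = 0 → x = 0} := by
  let Ψ : M →ₗ[ℝ] (S →L[ℝ] F) :=
    LinearMap.toContinuousLinearMap.toLinearMap ∘ₗ (LinearMap.lcomp ℝ F S.subtype) ∘ₗ Φ
  have hΨ : Continuous Ψ := LinearMap.continuous_of_finiteDimensional Ψ
  convert ContinuousLinearMap.isOpen_injective.preimage hΨ using 1
  ext B
  simp only [Set.mem_ofPred_eq, Set.mem_preimage]
  rw [injective_iff_map_eq_zero]
  simp [Ψ]

/-! ### Pattern subspaces and trace duality. -/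

section Pattern

variable {V : Type*} [Fintype V] [DecidableEq V]

/-- The symmetric matrices whose off-diagonal nonzero entries lie on edges of `H`; the diagonal is
unconstrained. -/
def patternSpace (H : SimpleGraph V) : Submodule ℝ (Matrix V V ℝ) where
  carrier := {Y | Y.IsSymm ∧ ∀ i j, i ≠ j → ¬ H.Adj i j → Y i j = 0}
  add_mem' := by
    rintro a b ⟨ha, ha'⟩ ⟨hb, hb'⟩
    exact ⟨ha.add hb, fun i j hij h => by simp [ha' i j hij h, hb' i j hij h]⟩
  zero_mem' := ⟨Matrix.isSymm_zero, by simp⟩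
  smul_mem' := by
    rintro c a ⟨ha, ha'⟩
    exact ⟨ha.smul c, fun i j hij h => by simp [ha' i j hij h]⟩

/-- The symmetric matrices with zero diagonal whose nonzero entries lie on edges of `H`. -/
def zeroDiagSpace (H : SimpleGraph V) : Submodule ℝ (Matrix V V ℝ) where
  carrier := closedClassZeroDiag H
  add_mem' := by
    rintro a b ⟨ha, ha0, ha'⟩ ⟨hb, hb0, hb'⟩
    refine ⟨ha.add hb, fun i => by simp [ha0, hb0], fun i j hij h => ?_⟩
    by_contra hH
    have h1 := not_imp_comm.1 (ha' i j hij) hH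
    have h2 := not_imp_comm.1 (hb' i j hij) hH
    exact h (by simp [h1, h2])
  zero_mem' := ⟨Matrix.isSymm_zero, by simp, by simp⟩
  smul_mem' := by
    rintro c a ⟨ha, ha0, ha'⟩
    refine ⟨ha.smul c, fun i => by simp [ha0], fun i j hij h => ha' i j hij fun h0 => h ?_⟩
    simp [h0]

variable (V) in
/-- The subspace of symmetric matrices. -/
def symmSpace : Submodule ℝ (Matrix V V ℝ) where
  carrier := {Y | Y.IsSymm}
  add_mem' ha hb := Matrix.IsSymm.add ha hb
  zero_mem' := Matrix.isSymm_zero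
  smul_mem' c _ ha := Matrix.IsSymm.smul ha c

variable (V) in
/-- The subspace of skew-symmetric matrices. -/
def skewSpace : Submodule ℝ (Matrix V V ℝ) where
  carrier := {Y | Yᵀ = -Y}
  add_mem' {a b} ha hb := by
    simp only [Set.mem_ofPred_eq] at *
    rw [Matrix.transpose_add, ha, hb]; abel
  zero_mem' := by simp
  smul_mem' c a ha := by
    simp only [Set.mem_ofPred_eq] at *
    rw [Matrix.transpose_smul, ha]; simp

theorem patternSpace_mono {H H' : SimpleGraph V} (h : H ≤ H') :
    patternSpace H ≤ patternSpace H' :=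
  fun _ hY => ⟨hY.1, fun i j hij hH => hY.2 i j hij fun hH' => hH (h hH')⟩

theorem mem_patternSpace_of_mem_matrixClass {G : SimpleGraph V} {A : Matrix V V ℝ}
    (hA : A ∈ matrixClass G) : A ∈ patternSpace G :=
  ⟨hA.1, fun i j hij h => not_imp_comm.1 (hA.2 i j hij).1 h⟩

/-- The symmetric matrix with ones at positions `(i,j)` and `(j,i)`. -/
def edgeMatrix (i j : V) : Matrix V V ℝ := Matrix.single i j 1 + Matrix.single j i 1

theorem edgeMatrix_isSymm (i j : V) : (edgeMatrix i j).IsSymm := by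
  simp [Matrix.IsSymm, edgeMatrix, add_comm]

theorem edgeMatrix_mem_patternSpace {H : SimpleGraph V} {i j : V} (h : i ≠ j → H.Adj i j) :
    edgeMatrix i j ∈ patternSpace H := by
  refine ⟨edgeMatrix_isSymm i j, fun k l hkl hH => ?_⟩
  simp only [edgeMatrix, Matrix.add_apply, Matrix.single_apply]
  rw [if_neg, if_neg, add_zero]
  · rintro ⟨rfl, rfl⟩; exact hH (h hkl.symm).symm
  · rintro ⟨rfl, rfl⟩; exact hH (h hkl)

theorem trace_mul_edgeMatrix (X : Matrix V V ℝ) (i j : V) :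
    (X * edgeMatrix i j).trace = X j i + X i j := by
  simp [edgeMatrix, Matrix.mul_add, Matrix.trace_add, Matrix.trace_mul_single]

/-- A linear functional is, on symmetric matrices, the trace pairing with a symmetric matrix. -/
theorem exists_isSymm_forall_eq_trace (φ : Matrix V V ℝ →ₗ[ℝ] ℝ) :
    ∃ X : Matrix V V ℝ, X.IsSymm ∧ ∀ Y : Matrix V V ℝ, Y.IsSymm → φ Y = (X * Y).trace := by
  let N : Matrix V V ℝ := Matrix.of fun i j => φ (Matrix.single j i 1)
  have hN : ∀ Y, φ Y = (N * Y).trace := fun Y => by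
    conv_lhs => rw [Matrix.matrix_eq_sum_single Y]
    simp only [map_sum, Matrix.trace, Matrix.diag_apply, Matrix.mul_apply]
    rw [Finset.sum_comm]
    refine Finset.sum_congr rfl fun i _ => Finset.sum_congr rfl fun j _ => ?_
    have : Matrix.single j i (Y j i) = Y j i • Matrix.single j i (1 : ℝ) := by
      simp
    rw [this, map_smul]
    simp [N, mul_comm]
  refine ⟨(1 / 2 : ℝ) • (N + Nᵀ), (Matrix.isSymm_add_transpose_self N).smul _, fun Y hY => ?_⟩
  have h2 : (Nᵀ * Y).trace = (N * Y).trace := by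
    rw [← Matrix.trace_transpose, Matrix.transpose_mul, Matrix.transpose_transpose, hY.eq,
      Matrix.trace_mul_comm]
  rw [hN, Matrix.smul_mul, Matrix.trace_smul, Matrix.add_mul, Matrix.trace_add, h2, smul_eq_mul]
  ring

/-- Trace duality: pattern matrices together with the image of `T` span the symmetric matrices as
soon as no nonzero symmetric matrix is orthogonal to both. -/
theorem exists_add_eq_of_forall_trace (H : SimpleGraph V) (K : Submodule ℝ (Matrix V V ℝ))
    (T : Matrix V V ℝ →ₗ[ℝ] Matrix V V ℝ) (hT : ∀ Z ∈ K, (T Z).IsSymm)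
    (hX : ∀ X ∈ closedClassZeroDiag Hᶜ, (∀ Z ∈ K, (X * T Z).trace = 0) → X = 0)
    (w : Matrix V V ℝ) (hw : w.IsSymm) :
    ∃ Z ∈ K, ∃ Y ∈ patternSpace H, Y + T Z = w := by
  by_contra hcon
  have hnot : w ∉ patternSpace H ⊔ K.map T := fun h => by
    obtain ⟨Y, hY, _, ⟨Z, hZ, rfl⟩, h⟩ := Submodule.mem_sup.1 h
    exact hcon ⟨Z, hZ, Y, hY, h⟩
  obtain ⟨φ, hφw, hφ⟩ := Submodule.exists_le_ker_of_notMem hnot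
  obtain ⟨X, hXs, hXφ⟩ := exists_isSymm_forall_eq_trace φ
  -- The case `i = j` is included, so the diagonal of `X` vanishes too.
  have hedge : ∀ i j, (i ≠ j → H.Adj i j) → X i j = 0 := fun i j h => by
    have h1 : φ (edgeMatrix i j) = 0 :=
      hφ (Submodule.mem_sup_left (edgeMatrix_mem_patternSpace h))
    rw [hXφ _ (edgeMatrix_isSymm i j), trace_mul_edgeMatrix, hXs.apply] at h1
    linarith
  refine hφw ?_
  rw [hXφ w hw, hX X ⟨hXs, fun i => hedge i i (by simp), fun i j hij h => ?_⟩, Matrix.zero_mul,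
    Matrix.trace_zero]
  · intro Z hZ
    rw [← hXφ _ (hT Z hZ)]
    exact hφ (Submodule.mem_sup_right (Submodule.mem_map_of_mem hZ))
  · rw [SimpleGraph.compl_adj]
    exact ⟨hij, fun hH => h (hedge i j fun _ => hH)⟩

end Pattern


/-! ### Perturbing `A` into `S(G + β)`. -/

section Perturbation

variable {V : Type*} [Fintype V] [DecidableEq V]

attribute [local instance] Matrix.linftyOpNormedAddCommGroup Matrix.linftyOpNormedSpace
  Matrix.linftyOpNormedRing Matrix.linftyOpNormedAlgebra

theorem addEdges_adj (G : SimpleGraph V) (β : Finset (Sym2 V)) (i j : V) :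
    (addEdges G β).Adj i j ↔ G.Adj i j ∨ (s(i, j) ∈ β ∧ i ≠ j) := by
  simp [addEdges]

theorem addEdges_mono (G : SimpleGraph V) {β' β : Finset (Sym2 V)} (h : β' ⊆ β) :
    addEdges G β' ≤ addEdges G β := by
  intro i j
  rw [addEdges_adj, addEdges_adj]
  exact Or.imp_right (And.imp_left fun h' => h h')

/-- Under the liberation hypothesis there is a tangent direction supported on `G + β` none of whose
entries at `β` vanishes. -/
theorem exists_direction (G : SimpleGraph V) (β : Finset (Sym2 V))
    (hβ : (β : Set (Sym2 V)) ⊆ Gᶜ.edgeSet) (K : Submodule ℝ (Matrix V V ℝ))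
    (T : Matrix V V ℝ →ₗ[ℝ] Matrix V V ℝ) (hT : ∀ Z ∈ K, (T Z).IsSymm)
    (hX : ∀ β' ⊆ β, β'.card + 1 = β.card → ∀ X ∈ closedClassZeroDiag (addEdges G β')ᶜ,
      (∀ Z ∈ K, (X * T Z).trace = 0) → X = 0) :
    ∃ Z ∈ K, ∃ Y ∈ patternSpace (addEdges G β), Y + T Z = 0 ∧
      ∀ i j, s(i, j) ∈ β → Y i j ≠ 0 := by
  let L : Matrix V V ℝ × Matrix V V ℝ →ₗ[ℝ] Matrix V V ℝ :=
    LinearMap.snd ℝ _ _ + T ∘ₗ LinearMap.fst ℝ _ _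
  let f : {e : V × V // s(e.1, e.2) ∈ β} → Module.Dual ℝ (Matrix V V ℝ × Matrix V V ℝ) :=
    fun e => Matrix.entryLinearMap ℝ ℝ e.1.1 e.1.2 ∘ₗ LinearMap.snd ℝ _ _
  obtain ⟨⟨Z, Y⟩, ⟨⟨hZ, hY⟩, hL⟩, hne⟩ := Module.Dual.exists_forall_mem_ne_zero_of_forall_exists
    ((K.prod (patternSpace (addEdges G β))) ⊓ LinearMap.ker L) f (by
      rintro ⟨⟨i, j⟩, he : s(i, j) ∈ β⟩
      have hG : i ≠ j ∧ ¬ G.Adj i j := by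
        have h : s(i, j) ∈ Gᶜ.edgeSet := hβ he
        rwa [SimpleGraph.mem_edgeSet, SimpleGraph.compl_adj] at h
      obtain ⟨Z, hZ, Y, hY, h⟩ := exists_add_eq_of_forall_trace (addEdges G (β.erase s(i, j))) K T hT
        (hX _ (Finset.erase_subset _ _) (Finset.card_erase_add_one he)) (edgeMatrix i j)
        (edgeMatrix_isSymm i j)
      -- `Y` vanishes at the removed edge, so the difference has entry `-1` there.
      refine ⟨(Z, Y - edgeMatrix i j), ⟨⟨hZ, Submodule.sub_mem _
        (patternSpace_mono (addEdges_mono G (Finset.erase_subset _ _)) hY)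
        (edgeMatrix_mem_patternSpace fun hij => ?_)⟩, ?_⟩, ?_⟩
      · exact (addEdges_adj G β i j).2 (Or.inr ⟨he, hij⟩)
      · change Y - edgeMatrix i j + T Z = 0
        rw [← h]
        abel
      · have h0 : Y i j = 0 := hY.2 i j hG.1 (by simp [addEdges_adj, hG.2])
        simp [f, h0, edgeMatrix, hG.1.symm])
  exact ⟨Z, hZ, Y, hY, by simpa [L] using hL, fun i j h => hne ⟨(i, j), h⟩⟩

/-- Under the liberation hypothesis, `A` can be moved along a family of matrix equations with
tangent map `T` to nearby matrices in `S(G + β)`. -/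
theorem exists_perturbed_mem_matrixClass (G : SimpleGraph V) (β : Finset (Sym2 V))
    (hβ0 : β.Nonempty) (hβ : (β : Set (Sym2 V)) ⊆ Gᶜ.edgeSet) (A : Matrix V V ℝ)
    (hA : A ∈ matrixClass G) (K : Submodule ℝ (Matrix V V ℝ))
    (T : Matrix V V ℝ →ₗ[ℝ] Matrix V V ℝ) (hT : ∀ Z ∈ K, (T Z).IsSymm)
    (R : ℝ × Matrix V V ℝ × Matrix V V ℝ → Matrix V V ℝ) (hR : ContDiff ℝ 1 R)
    (hRs : ∀ t, ∀ Z ∈ K, ∀ Y : Matrix V V ℝ, Y.IsSymm → (R (t, Z, Y)).IsSymm)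
    (hX : ∀ β' ⊆ β, β'.card + 1 = β.card → ∀ X ∈ closedClassZeroDiag (addEdges G β')ᶜ,
      (∀ Z ∈ K, (X * T Z).trace = 0) → X = 0)
    (s r : Set (Matrix V V ℝ)) (hs : s ∈ 𝓝 A) (hr : r ∈ 𝓝 (0 : Matrix V V ℝ)) :
    ∃ t : ℝ, ∃ Z ∈ K, ∃ Y, t • Z ∈ r ∧ A + t • Y ∈ s ∧ A + t • Y ∈ matrixClass (addEdges G β) ∧
      Y + T Z + t • R (t, Z, Y) = 0 := by
  obtain ⟨Z₀, hZ₀, Y₀, hY₀, hL₀, hne⟩ := exists_direction G β hβ K T hT hX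
  let L : Matrix V V ℝ × Matrix V V ℝ →ₗ[ℝ] Matrix V V ℝ :=
    LinearMap.snd ℝ _ _ + T ∘ₗ LinearMap.fst ℝ _ _
  have hsurj : ∀ w ∈ symmSpace V, ∃ u ∈ K.prod (patternSpace (addEdges G β)), L u = w := by
    intro w hw
    obtain ⟨e, he⟩ := hβ0
    obtain ⟨Z, hZ, Y, hY, h⟩ := exists_add_eq_of_forall_trace _ K T hT
        (hX _ (Finset.erase_subset e _) (Finset.card_erase_add_one he)) w hw
    exact ⟨(Z, Y), ⟨hZ, patternSpace_mono (addEdges_mono G (Finset.erase_subset _ _)) hY⟩, h⟩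
  have hmove : Tendsto (fun x : ℝ × Matrix V V ℝ × Matrix V V ℝ => A + x.1 • x.2.2)
      (𝓝 (0, Z₀, Y₀)) (𝓝 A) := by
    have : Continuous (fun x : ℝ × Matrix V V ℝ × Matrix V V ℝ => A + x.1 • x.2.2) := by fun_prop
    simpa using this.tendsto (0, Z₀, Y₀)
  have hsmall : Tendsto (fun x : ℝ × Matrix V V ℝ × Matrix V V ℝ => x.1 • x.2.1)
      (𝓝 (0, Z₀, Y₀)) (𝓝 0) := by
    have : Continuous (fun x : ℝ × Matrix V V ℝ × Matrix V V ℝ => x.1 • x.2.1) := by fun_prop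
    simpa using this.tendsto (0, Z₀, Y₀)
  have hentry : ∀ i j, Continuous fun B : Matrix V V ℝ => B i j := fun i j =>
    continuous_id.matrix_elem i j
  have h1 : ∀ᶠ x in 𝓝 ((0 : ℝ), Z₀, Y₀), ∀ i j, A i j ≠ 0 → (A + x.1 • x.2.2) i j ≠ 0 := by
    refine eventually_all.2 fun i => eventually_all.2 fun j => ?_
    by_cases h : A i j = 0
    · simp [h]
    · filter_upwards [(((hentry i j).tendsto A).comp hmove).eventually_ne h] with x hx _
      exact hx
  have h2 : ∀ᶠ x in 𝓝 ((0 : ℝ), Z₀, Y₀), ∀ i j, s(i, j) ∈ β → x.2.2 i j ≠ 0 := by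
    refine eventually_all.2 fun i => eventually_all.2 fun j => ?_
    by_cases h : s(i, j) ∈ β
    · have hc : Continuous fun x : ℝ × Matrix V V ℝ × Matrix V V ℝ => x.2.2 i j :=
        (hentry i j).comp (continuous_snd.comp continuous_snd)
      filter_upwards [(hc.tendsto (0, Z₀, Y₀)).eventually_ne (hne i j h)] with x hx _
      exact hx
    · simp [h]
  have hev := exists_zero_of_perturbation (K.prod (patternSpace (addEdges G β))) (symmSpace V) L R hR
    (fun u hu => (hu.2.1).add (hT _ hu.1)) (fun t u hu => hRs t u.1 hu.1 u.2 hu.2.1) hsurj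
    (Z₀, Y₀) ⟨hZ₀, hY₀⟩ hL₀ _ (((h1.and h2).and (hmove hs)).and (hsmall hr))
  -- A nonzero `t` is needed: the entries of `A + t • Y` on `β` are `t * Y i j`.
  obtain ⟨t, ⟨⟨Z, Y⟩, ⟨hZ, hY⟩, ⟨⟨⟨hA', hY'⟩, hmem⟩, hZr⟩, heq⟩, ht⟩ :=
    ((hev.filter_mono nhdsWithin_le_nhds).and (self_mem_nhdsWithin (s := {(0 : ℝ)}ᶜ))).exists
  refine ⟨t, Z, hZ, Y, hZr, hmem, ⟨hA.1.add (hY.1.smul t), fun i j hij => ?_⟩, heq⟩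
  rw [addEdges_adj]
  by_cases hG : G.Adj i j
  · simpa [hG] using hA' i j ((hA.2 i j hij).2 hG)
  · have hA0 : A i j = 0 := not_imp_comm.1 (hA.2 i j hij).1 hG
    by_cases hb : s(i, j) ∈ β
    · have := hY' i j hb
      have ht0 : t ≠ 0 := ht
      simp_all
    · have : Y i j = 0 := hY.2 i j hij (by simp [addEdges_adj, hG, hb])
      simp [hG, hb, hA0, this]

/-! ### Openness of the strong properties; invariance of spectrum and nullity. -/

theorem isOpen_hasSSPWrt (H : SimpleGraph V) : IsOpen {B : Matrix V V ℝ | HasSSPWrt B H} :=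
  isOpen_setOf_forall_eq_zero (LinearMap.mul ℝ (Matrix V V ℝ) - (LinearMap.mul ℝ _).flip)
    (zeroDiagSpace Hᶜ)

theorem isOpen_hasSAPWrt (H : SimpleGraph V) : IsOpen {B : Matrix V V ℝ | HasSAPWrt B H} :=
  isOpen_setOf_forall_eq_zero (LinearMap.mul ℝ (Matrix V V ℝ)) (zeroDiagSpace Hᶜ)

theorem closedClassZeroDiag_compl_anti {H H' : SimpleGraph V} (h : H ≤ H') :
    closedClassZeroDiag H'ᶜ ⊆ closedClassZeroDiag Hᶜ :=
  fun _ hX => ⟨hX.1, hX.2.1, fun i j hij hne =>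
    (compl_le_compl h) (hX.2.2 i j hij hne)⟩

theorem mem_closedClassZeroDiag_compl {H : SimpleGraph V} {B X : Matrix V V ℝ}
    (hB : B ∈ matrixClass H) (hX : X.IsSymm) (hBX : B ⊙ X = 0)
    (h1 : (1 : Matrix V V ℝ) ⊙ X = 0) : X ∈ closedClassZeroDiag Hᶜ := by
  refine ⟨hX, fun i => ?_, fun i j hij hne => ?_⟩
  · simpa using congrFun (congrFun h1 i) i
  · have h := congrFun (congrFun hBX i) j
    simp only [Matrix.hadamard_apply, Matrix.zero_apply, mul_eq_zero, hne, or_false] at h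
    rw [SimpleGraph.compl_adj]
    exact ⟨hij, fun hH => (hB.2 i j hij).2 hH h⟩

theorem HasSSPWrt.hasSSP {H : SimpleGraph V} {B : Matrix V V ℝ} (hB : B ∈ matrixClass H)
    (h : HasSSPWrt B H) : HasSSP B :=
  ⟨hB.1, fun X hX hBX h1 => h X (mem_closedClassZeroDiag_compl hB hX hBX h1)⟩

theorem HasSAPWrt.hasSAP {H : SimpleGraph V} {B : Matrix V V ℝ} (hB : B ∈ matrixClass H)
    (h : HasSAPWrt B H) : HasSAP B :=
  ⟨hB.1, fun X hX hBX h1 => h X (mem_closedClassZeroDiag_compl hB hX hBX h1)⟩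

theorem isUnit_one_add_mem_nhds : {K : Matrix V V ℝ | IsUnit (1 + K)} ∈ 𝓝 (0 : Matrix V V ℝ) := by
  have hc : Continuous fun K : Matrix V V ℝ => (1 + K).det :=
    (continuous_const.add continuous_id).matrix_det
  filter_upwards [(hc.tendsto 0).eventually_ne (by simp : (1 + (0 : Matrix V V ℝ)).det ≠ 0)]
    with K hK
  exact (Matrix.isUnit_iff_isUnit_det _).2 hK.isUnit

theorem isUnit_one_sub_mem_nhds : {K : Matrix V V ℝ | IsUnit (1 - K)} ∈ 𝓝 (0 : Matrix V V ℝ) := by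
  have hc : Tendsto (fun K : Matrix V V ℝ => -K) (𝓝 0) (𝓝 0) := by
    simpa using (continuous_neg (G := Matrix V V ℝ)).tendsto 0
  filter_upwards [hc isUnit_one_add_mem_nhds] with K hK
  simpa [sub_eq_add_neg] using hK

/-- Two matrices related by a Cayley transform are isospectral. -/
theorem spectrum_eq_of_cayley {A B K : Matrix V V ℝ} (hp : IsUnit (1 + K)) (hm : IsUnit (1 - K))
    (h : (1 + K) * B * (1 - K) = (1 - K) * A * (1 + K)) : spectrum ℝ B = spectrum ℝ A := by
  obtain ⟨u, hu⟩ := hp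
  obtain ⟨v, hv⟩ := hm
  rw [← hu, ← hv] at h
  -- Both are polynomials in `K`; commuting turns `u⁻¹ v A u v⁻¹` into a conjugate of `A`.
  have hcomm : Commute u v := Units.ext (by simp only [Units.val_mul, hu, hv]; noncomm_ring)
  have hB : B = (u⁻¹ * v).val * A * (u⁻¹ * v)⁻¹.val := by
    have hinv : (u⁻¹ * v)⁻¹ = u * v⁻¹ := by
      rw [mul_inv_rev, inv_inv]; exact (hcomm.inv_right).eq.symm
    rw [hinv, Units.val_mul, Units.val_mul]
    have : B = u⁻¹.val * (u.val * B * v.val) * v⁻¹.val := by simp [mul_assoc]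
    rw [this, h]
    simp only [mul_assoc]
  rw [hB, spectrum.units_conjugate]

theorem nullity_transpose_mul_mul {A P : Matrix V V ℝ} (hP : IsUnit P) :
    nullity (Pᵀ * A * P) = nullity A := by
  have hd := (Matrix.isUnit_iff_isUnit_det P).1 hP
  have hr : (Pᵀ * A * P).rank = A.rank := by
    rw [Matrix.rank_mul_eq_left_of_isUnit_det _ _ hd,
      Matrix.rank_mul_eq_right_of_isUnit_det _ _ (by rwa [Matrix.det_transpose])]
  have h1 := LinearMap.finrank_range_add_finrank_ker (Pᵀ * A * P).mulVecLin
  have h2 := LinearMap.finrank_range_add_finrank_ker A.mulVecLin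
  unfold Matrix.rank at hr
  unfold nullity
  omega

/-! ### Liberation of a single matrix. -/

/-- An SSP liberation set of `A` yields an isospectral matrix in `S(G + β)` with the SSP. -/
theorem IsMatrixSSPLiberationSet.exists_hasSSP {G : SimpleGraph V} {β : Finset (Sym2 V)}
    {A : Matrix V V ℝ} (hA : A ∈ matrixClass G) (h : IsMatrixSSPLiberationSet G A β) :
    ∃ B ∈ matrixClass (addEdges G β), HasSSP B ∧ spectrum ℝ B = spectrum ℝ A := by
  obtain ⟨hβ0, hβ, hS⟩ := h
  have hAt : Aᵀ = A := hA.1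
  have hsymm : HasSSPWrt A (addEdges G β) := by
    obtain ⟨e, he⟩ := hβ0
    intro X hX
    exact hS _ (Finset.erase_subset e β) (Finset.card_erase_add_one he) X
      (closedClassZeroDiag_compl_anti (addEdges_mono G (Finset.erase_subset e β)) hX)
  obtain ⟨t, Z, hZ, Y, ⟨hp, hm⟩, hssp, hcl, heq⟩ := exists_perturbed_mem_matrixClass G β hβ0 hβ A hA
    (skewSpace V) ((2 : ℝ) • (LinearMap.mulRight ℝ A - LinearMap.mulLeft ℝ A))
    (fun Z (hZ : Zᵀ = -Z) => by
      simp only [LinearMap.smul_apply, LinearMap.sub_apply, LinearMap.mulRight_apply,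
        LinearMap.mulLeft_apply]
      refine Matrix.IsSymm.smul ?_ _
      rw [Matrix.IsSymm, Matrix.transpose_sub, Matrix.transpose_mul, Matrix.transpose_mul, hZ, hAt]
      noncomm_ring)
    (fun x => x.2.1 * x.2.2 - x.2.2 * x.2.1 - x.1 • (x.2.1 * x.2.2 * x.2.1))
    (by fun_prop)
    (fun t Z (hZ : Zᵀ = -Z) Y (hY : Yᵀ = Y) => by
      simp only [Matrix.IsSymm, Matrix.transpose_sub, Matrix.transpose_mul, Matrix.transpose_smul,
        hZ, hY]
      simp only [neg_mul, mul_neg, neg_neg, mul_assoc]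
      abel)
    -- Testing with the skew matrix `W = [A, X]` gives `tr (W * W) = 0`, which is `-tr (Wᵀ * W)`;
    -- hence `W = 0`.
    (fun β' hsub hcard X hX hZ => hS β' hsub hcard X hX (by
      have hXt : Xᵀ = X := hX.1
      have hW : (A * X - X * A)ᵀ = -(A * X - X * A) := by
        rw [Matrix.transpose_sub, Matrix.transpose_mul, Matrix.transpose_mul, hAt, hXt]; abel
      have h0 := hZ _ hW
      simp only [LinearMap.smul_apply, LinearMap.sub_apply, LinearMap.mulRight_apply,
        LinearMap.mulLeft_apply, Matrix.mul_smul, Matrix.trace_smul, smul_eq_mul, mul_eq_zero,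
        OfNat.ofNat_ne_zero, false_or] at h0
      generalize hWdef : A * X - X * A = W at *
      rw [← Matrix.trace_conjTranspose_mul_self_eq_zero_iff, Matrix.conjTranspose_eq_transpose_of_trivial,
        hW, neg_mul, Matrix.trace_neg, neg_eq_zero]
      nth_rw 2 [← hWdef]
      rw [Matrix.mul_sub, Matrix.trace_sub] at h0 ⊢
      rw [← mul_assoc W A X, Matrix.trace_mul_comm (W * A) X, ← mul_assoc W X A,
        Matrix.trace_mul_comm (W * X) A, ← mul_assoc A W X, Matrix.trace_mul_comm (A * W) X]
      exact h0))
    {B | HasSSPWrt B (addEdges G β)} ({K | IsUnit (1 + K)} ∩ {K | IsUnit (1 - K)})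
    ((isOpen_hasSSPWrt _).mem_nhds hsymm)
    (inter_mem isUnit_one_add_mem_nhds isUnit_one_sub_mem_nhds)
  refine ⟨A + t • Y, hcl, HasSSPWrt.hasSSP hcl hssp, spectrum_eq_of_cayley hp hm ?_⟩
  have := congrArg (fun M => t • M) heq
  simp only [LinearMap.smul_apply, LinearMap.sub_apply, LinearMap.mulRight_apply,
        LinearMap.mulLeft_apply, smul_zero] at this
  rw [← sub_eq_zero, ← this]
  simp only [mul_add, add_mul, mul_sub, sub_mul, smul_add, smul_sub, Matrix.smul_mul,
    Matrix.mul_smul, one_mul, mul_one, two_smul, mul_assoc]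
  abel

/-- An SAP liberation set of `A` yields a matrix in `S(G + β)` with the SAP and the same nullity. -/
theorem IsMatrixSAPLiberationSet.exists_hasSAP {G : SimpleGraph V} {β : Finset (Sym2 V)}
    {A : Matrix V V ℝ} (hA : A ∈ matrixClass G) (h : IsMatrixSAPLiberationSet G A β) :
    ∃ B ∈ matrixClass (addEdges G β), HasSAP B ∧ nullity B = nullity A := by
  obtain ⟨hβ0, hβ, hS⟩ := h
  have hAt : Aᵀ = A := hA.1
  have hsymm : HasSAPWrt A (addEdges G β) := by
    obtain ⟨e, he⟩ := hβ0
    intro X hX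
    exact hS _ (Finset.erase_subset e β) (Finset.card_erase_add_one he) X
      (closedClassZeroDiag_compl_anti (addEdges_mono G (Finset.erase_subset e β)) hX)
  let tr : Matrix V V ℝ →ₗ[ℝ] Matrix V V ℝ := (Matrix.transposeLinearEquiv V V ℝ ℝ).toLinearMap
  have hT : ∀ Z, (-(LinearMap.mulRight ℝ A ∘ₗ tr + LinearMap.mulLeft ℝ A)) Z
      = -(Zᵀ * A + A * Z) := fun Z => by
    simp [tr]
  have htr : ContDiff ℝ 1 tr := (LinearMap.toContinuousLinearMap tr).contDiff
  obtain ⟨t, Z, -, Y, hp, hsap, hcl, heq⟩ := exists_perturbed_mem_matrixClass G β hβ0 hβ A hA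
    ⊤ (-(LinearMap.mulRight ℝ A ∘ₗ tr + LinearMap.mulLeft ℝ A))
    (fun Z _ => by
      rw [hT, Matrix.IsSymm, Matrix.transpose_neg, Matrix.transpose_add, Matrix.transpose_mul,
        Matrix.transpose_mul, hAt, Matrix.transpose_transpose, add_comm])
    (fun x => -(tr x.2.1 * A * x.2.1))
    (by fun_prop)
    (fun t Z _ Y _ => by
      simp [tr, Matrix.IsSymm, Matrix.transpose_mul, hAt, mul_assoc])
    (fun β' hsub hcard X hX hZ => hS β' hsub hcard X hX (by
      have hXt : Xᵀ = X := hX.1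
      -- With `Z = A * X` the pairing is `-2 tr ((A * X)ᵀ * (A * X))`, so `A * X = 0`.
      have h0 := hZ (A * X) trivial
      rw [hT] at h0
      rw [← Matrix.trace_conjTranspose_mul_self_eq_zero_iff,
        Matrix.conjTranspose_eq_transpose_of_trivial]
      rw [Matrix.transpose_mul, hAt, hXt, Matrix.mul_neg, Matrix.trace_neg, Matrix.mul_add,
        Matrix.trace_add, neg_eq_zero] at *
      have e1 : (X * (X * A * A)).trace = (X * A * (A * X)).trace := by
        rw [Matrix.trace_mul_comm]; simp only [mul_assoc]
      have e2 : X * (A * (A * X)) = X * A * (A * X) := by simp only [mul_assoc]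
      rw [e1, e2] at h0
      linarith))
    {B | HasSAPWrt B (addEdges G β)} {K | IsUnit (1 + K)}
    ((isOpen_hasSAPWrt _).mem_nhds hsymm) isUnit_one_add_mem_nhds
  refine ⟨A + t • Y, hcl, HasSAPWrt.hasSAP hcl hsap, ?_⟩
  rw [← nullity_transpose_mul_mul (A := A) hp]
  congr 1
  have := congrArg (fun M => t • M) heq
  simp only [hT, smul_zero] at this
  rw [← sub_eq_zero, ← this]
  simp only [tr, LinearEquiv.coe_coe, Matrix.transposeLinearEquiv_apply, Matrix.transpose_add,
    Matrix.transpose_one, Matrix.transpose_smul, mul_add, add_mul, smul_add, smul_neg,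
    Matrix.smul_mul, Matrix.mul_smul, one_mul, mul_one, mul_assoc]
  abel

/-! ### The graph parameters. -/

/-- Every graph has a matrix with the SSP. -/
theorem exists_hasSSP (G : SimpleGraph V) : ∃ A ∈ matrixClass G, HasSSP A := by
  classical
  let d : V → ℝ := fun i => (Fintype.equivFin V i : ℕ)
  have hd : ∀ i j, i ≠ j → d i ≠ d j := fun i j hij h =>
    hij ((Fintype.equivFin V).injective (Fin.ext (Nat.cast_injective h)))
  -- Only diagonal matrices commute with a diagonal matrix with distinct entries; a small multiple
  -- of the adjacency matrix then supplies the pattern of `G`.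
  have h0 : HasSSPWrt (Matrix.diagonal d) G := by
    rintro X ⟨-, hX0, -⟩ hX
    ext i j
    by_cases hij : i = j
    · subst hij; exact hX0 i
    · have := congrFun (congrFun hX i) j
      simp only [Matrix.sub_apply, Matrix.diagonal_mul, Matrix.mul_diagonal, Matrix.zero_apply]
        at this
      have h : (d i - d j) * X i j = 0 := by linarith
      exact (mul_eq_zero.1 h).resolve_left (sub_ne_zero.2 (hd i j hij))
  have hc : Tendsto (fun t : ℝ => Matrix.diagonal d + t • G.adjMatrix ℝ) (𝓝 0)
      (𝓝 (Matrix.diagonal d)) := by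
    have : Continuous (fun t : ℝ => Matrix.diagonal d + t • G.adjMatrix ℝ) := by fun_prop
    simpa using this.tendsto 0
  have hev : ∀ᶠ t in 𝓝 (0 : ℝ), HasSSPWrt (Matrix.diagonal d + t • G.adjMatrix ℝ) G :=
    hc ((isOpen_hasSSPWrt G).mem_nhds h0)
  obtain ⟨t, hs, ht⟩ := ((hev.filter_mono nhdsWithin_le_nhds).and
    (self_mem_nhdsWithin (s := {(0 : ℝ)}ᶜ))).exists
  have ht0 : t ≠ 0 := ht
  have hmem : Matrix.diagonal d + t • G.adjMatrix ℝ ∈ matrixClass G := by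
    refine ⟨(Matrix.isSymm_diagonal d).add ((G.isSymm_adjMatrix).smul t), fun i j hij => ?_⟩
    simp [Matrix.diagonal_apply_ne _ hij, SimpleGraph.adjMatrix_apply, ht0]
  exact ⟨_, hmem, HasSSPWrt.hasSSP hmem hs⟩

/-- `sInf ∅ = 0` in `ℕ`, so the bound relies on some matrix in `S(G)` having the SSP. -/
theorem q_le_qS (G : SimpleGraph V) : q G ≤ qS G := by
  obtain ⟨A, hA, hS⟩ := exists_hasSSP G
  obtain ⟨B, hB, -, hk⟩ := Nat.sInf_mem
    (s := {k | ∃ A ∈ matrixClass G, HasSSP A ∧ numDistinctEigenvalues A = k}) ⟨_, A, hA, hS, rfl⟩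
  exact Nat.sInf_le ⟨B, hB, hk⟩

theorem nullity_le_card (A : Matrix V V ℝ) : nullity A ≤ Fintype.card V := by
  simpa [nullity] using Submodule.finrank_le (LinearMap.ker A.mulVecLin)

/-- An empty supremum is `0`, so no matrix with the SAP has to be exhibited; boundedness by `|V|` is
what matters. -/
theorem xi_le_maxNullity (G : SimpleGraph V) : xi G ≤ maxNullity G := by
  refine csSup_le' ?_
  rintro _ ⟨A, hA, -, rfl⟩
  refine le_csSup ⟨Fintype.card V, ?_⟩ ⟨A, hA, rfl⟩
  rintro _ ⟨B, -, rfl⟩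
  exact nullity_le_card B

theorem IsSSPLiberationSet.qS_addEdges_le {G : SimpleGraph V} {β : Finset (Sym2 V)}
    (h : IsSSPLiberationSet G β) : qS (addEdges G β) ≤ q G := by
  obtain ⟨A₀, hA₀, -⟩ := exists_hasSSP G
  obtain ⟨A, hA, hk⟩ := Nat.sInf_mem
    (s := {k | ∃ A ∈ matrixClass G, numDistinctEigenvalues A = k}) ⟨_, A₀, hA₀, rfl⟩
  obtain ⟨B, hB, hS, hspec⟩ := (h A hA).exists_hasSSP hA
  refine Nat.sInf_le ⟨B, hB, hS, ?_⟩
  rw [numDistinctEigenvalues, hspec]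
  exact hk

theorem IsSAPLiberationSet.le_xi_addEdges {G : SimpleGraph V} {β : Finset (Sym2 V)}
    (h : IsSAPLiberationSet G β) : maxNullity G ≤ xi (addEdges G β) := by
  refine csSup_le' ?_
  rintro _ ⟨A, hA, rfl⟩
  obtain ⟨B, hB, hS, hn⟩ := (h A hA).exists_hasSAP hA
  refine le_csSup ⟨Fintype.card V, ?_⟩ ⟨B, hB, hS, hn⟩
  rintro _ ⟨B, -, -, rfl⟩
  exact nullity_le_card B

end Perturbation

end Liberation

theorem corollary4p4 {V : Type*} [Fintype V] [DecidableEq V]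
    (G : SimpleGraph V) (β : Finset (Sym2 V)) :
    (Liberation.IsSSPLiberationSet G β →
      Liberation.q (Liberation.addEdges G β) ≤ Liberation.qS (Liberation.addEdges G β) ∧
      Liberation.qS (Liberation.addEdges G β) ≤ Liberation.q G ∧
      Liberation.q G ≤ Liberation.qS G) ∧
    (Liberation.IsSAPLiberationSet G β →
      Liberation.maxNullity (Liberation.addEdges G β) ≥ Liberation.xi (Liberation.addEdges G β) ∧
      Liberation.xi (Liberation.addEdges G β) ≥ Liberation.maxNullity G ∧
      Liberation.maxNullity G ≥ Liberation.xi G) :=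
  ⟨fun h => ⟨Liberation.q_le_qS _, h.qS_addEdges_le, Liberation.q_le_qS _⟩,
    fun h => ⟨Liberation.xi_le_maxNullity _, h.le_xi_addEdges, Liberation.xi_le_maxNullity _⟩⟩
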